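/- Let $k$ be a field of characteristic zero; $\otimes$ is the tensor product over $k$, $I$ denotes identity maps and $S(x\otimes y)=y\otimes x$. A (linear) \emph{Boolean algebra} is a $k$-vector space $V$ with linear maps $\cup,\cap:V\otimes V\to V$, $c:V\to V$, $E:k\to V$ (empty map), $T:k\to V$ (total map), $\Delta:V\to V\otimes V$ and $ev:V\to k$ such that (1) $\cup=\cup\circ S$, $\cap=\cap\circ S$; (2) $\cup\circ(\cup\otimes I)=\cup\circ(I\otimes\cup)$, $\cap\circ(\cap\otimes I)=\cap\circ(I\otimes\cap)$; (3) $\cap\circ(I\otimes\cup)=\cup\circ(\cap\otimes\cap)\circ(I\otimes S\otimes I)\circ(\Delta\otimes I\otimes I)$ and $\cup\circ(I\otimes\cap)=\cap\circ(\cup\otimes\cup)\circ(I\otimes S\otimes I)\circ(\Delta\otimes I\otimes I)$; (4) $\cup\circ(I\otimes E)=I$, $\cap\circ(I\otimes T)=I$; (5) $\cap\circ(I\otimes c)\circ\Delta=E\circ ev$, $\cup\circ(I\otimes c)\circ\Delta=T\circ ev$; (6) $\cap\circ(I\otimes\cup)\circ(\Delta\otimes I)=I\otimes ev$, $\cup\circ(I\otimes\cap)\circ(\Delta\otimes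 I)=I\otimes ev$; (7) $(\Delta\otimes I)\circ\Delta=(I\otimes\Delta)\circ\Delta$; (8) $S\circ\Delta=\Delta$. A \emph{prop} in sets is a strict symmetric monoidal category with set of objects $\mathbb N$ and with addition as tensor product on objects; a prop in $k$-vector spaces is one whose sets of morphisms are $k$-vector spaces, with bilinear composition and tensor product. Morphisms of props in vector spaces are the $k$-linear strict symmetric monoidal functors that are the identity on objects. For a vector space $V$, $\mathrm{End}_V$ is the prop with $\mathrm{End}_V(n,m)=\mathrm{Hom}_k(V^{\otimes n},V^{\otimes m})$, and for a prop $P$ in vector spaces a $P$-algebra structure on $V$ is a morphism of props $P\to\mathrm{End}_V$. Let $\mathrm{Boole}$ be the prop in sets presented by generators $\cup,\cap$ (from $2$ to $1$), $c$ (from $1$ to $1$), $\Delta$ (from $1$ to $2$), $e,t$ (from $0$ to $1$) and $ev$ (from $1$ to $0$), with the relations (1)--(8) read as equations between morphisms of the prop, with $e$ for $E$ and $t$ for $T$: that is, the free prop on these generators modulo the smallest congruence of props containing these relations. For a prop $P$ in sets let $\langle P\rangle(n,m)$ be the free $k$-vector space on $P(n,m)$, with composition and tensor product extended bilinearly. \textbf{Theorem.}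 $\langle\mathrm{Boole}\rangle$ is a prop in $k$-vector spaces and, for every $k$-vector space $V$, the $\langle\mathrm{Boole}\rangle$-algebra structures on $V$ are exactly the Boolean algebra structures on $V$: sending $r:\langle\mathrm{Boole}\rangle\to\mathrm{End}_V$ to the images under $r$ of the generators (with $V^{\otimes 0}=k$, $V^{\otimes 1}=V$, $V^{\otimes 2}=V\otimes V$) is a bijection from the set of prop morphisms $\langle\mathrm{Boole}\rangle\to\mathrm{End}_V$ onto the set of Boolean algebra structures on $V$. -/

import Mathlib

open scoped TensorProduct

universe u v w

/-! ## Props in sets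

A prop is a strict symmetric monoidal category whose objects are the natural numbers and whose
tensor product on objects is addition. Since `(a + b) + c` and `a + (b + c)` are only
propositionally equal, the strictness axioms transport morphisms along equalities of objects. -/

/-- Transport of an element of a doubly indexed family along equalities of the indices. -/
def castHom (H : ℕ → ℕ → Type u) {a a' b b' : ℕ} (ha : a = a') (hb : b = b') (f : H a b) :
    H a' b' :=
  ha ▸ hb ▸ f

/-- A prop over `Set`: a strict symmetric monoidal category with set of objects `ℕ` and with
`+` as tensor product of objects. Composition is written in diagrammatic order. -/
structure SetPROP where
  Hom : ℕ → ℕ → Type u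
  id : ∀ n, Hom n n
  comp : ∀ {a b c : ℕ}, Hom a b → Hom b c → Hom a c
  tensor : ∀ {a b c d : ℕ}, Hom a b → Hom c d → Hom (a + c) (b + d)
  /-- the symmetry -/
  swap : ∀ m n : ℕ, Hom (m + n) (n + m)
  id_comp : ∀ {a b : ℕ} (f : Hom a b), comp (id a) f = f
  comp_id : ∀ {a b : ℕ} (f : Hom a b), comp f (id b) = f
  comp_assoc : ∀ {a b c d : ℕ} (f : Hom a b) (g : Hom b c) (h : Hom c d),
    comp (comp f g) h = comp f (comp g h)
  tensor_id : ∀ m n : ℕ, tensor (id m) (id n) = id (m + n)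
  tensor_comp : ∀ {a b c a' b' c' : ℕ} (f : Hom a b) (g : Hom b c) (f' : Hom a' b')
    (g' : Hom b' c'), tensor (comp f g) (comp f' g') = comp (tensor f f') (tensor g g')
  id_zero_tensor : ∀ {a b : ℕ} (f : Hom a b),
    castHom Hom (Nat.zero_add a) (Nat.zero_add b) (tensor (id 0) f) = f
  tensor_id_zero : ∀ {a b : ℕ} (f : Hom a b),
    castHom Hom (Nat.add_zero a) (Nat.add_zero b) (tensor f (id 0)) = f
  tensor_assoc : ∀ {a b c a' b' c' : ℕ} (f : Hom a a') (g : Hom b b') (h : Hom c c'),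
    castHom Hom (Nat.add_assoc a b c) (Nat.add_assoc a' b' c') (tensor (tensor f g) h) =
      tensor f (tensor g h)
  swap_natural : ∀ {a b c d : ℕ} (f : Hom a b) (g : Hom c d),
    comp (tensor f g) (swap b d) = comp (swap a c) (tensor g f)
  swap_swap : ∀ m n : ℕ, comp (swap m n) (swap n m) = id (m + n)
  swap_add : ∀ a b c : ℕ, swap a (b + c) =
    comp (castHom Hom (Nat.add_assoc a b c) (Nat.add_assoc b a c) (tensor (swap a b) (id c)))
      (castHom Hom rfl (Nat.add_assoc b c a).symm (tensor (id b) (swap a c)))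

/-! ## Props in vector spaces -/

/-- A prop over the category of `k`-vector spaces: a prop whose sets of morphisms are vector
spaces, with bilinear composition and bilinear tensor product. -/
structure LinPROP (k : Type u) [Field k] extends SetPROP.{v} where
  [addCommGroup : ∀ n m, AddCommGroup (Hom n m)]
  [module : ∀ n m, Module k (Hom n m)]
  add_comp : ∀ {a b c : ℕ} (f f' : Hom a b) (g : Hom b c),
    comp (f + f') g = comp f g + comp f' g
  smul_comp : ∀ {a b c : ℕ} (s : k) (f : Hom a b) (g : Hom b c),
    comp (s • f) g = s • comp f g
  comp_add : ∀ {a b c : ℕ} (f : Hom a b) (g g' : Hom b c),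
    comp f (g + g') = comp f g + comp f g'
  comp_smul : ∀ {a b c : ℕ} (s : k) (f : Hom a b) (g : Hom b c),
    comp f (s • g) = s • comp f g
  add_tensor : ∀ {a b c d : ℕ} (f f' : Hom a b) (g : Hom c d),
    tensor (f + f') g = tensor f g + tensor f' g
  smul_tensor : ∀ {a b c d : ℕ} (s : k) (f : Hom a b) (g : Hom c d),
    tensor (s • f) g = s • tensor f g
  tensor_add : ∀ {a b c d : ℕ} (f : Hom a b) (g g' : Hom c d),
    tensor f (g + g') = tensor f g + tensor f g'
  tensor_smul : ∀ {a b c d : ℕ} (s : k) (f : Hom a b) (g : Hom c d),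
    tensor f (s • g) = s • tensor f g

attribute [instance] LinPROP.addCommGroup LinPROP.module

/-- A morphism of props in vector spaces: a `k`-linear strict symmetric monoidal functor which is
the identity on objects. -/
@[ext]
structure LinPROP.Morphism {k : Type u} [Field k] (P : LinPROP.{u, v} k)
    (Q : LinPROP.{u, w} k) where
  map : ∀ n m : ℕ, P.Hom n m →ₗ[k] Q.Hom n m
  map_id : ∀ n, map n n (P.id n) = Q.id n
  map_comp : ∀ {a b c : ℕ} (f : P.Hom a b) (g : P.Hom b c),
    map a c (P.comp f g) = Q.comp (map a b f) (map b c g)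
  map_tensor : ∀ {a b c d : ℕ} (f : P.Hom a b) (g : P.Hom c d),
    map (a + c) (b + d) (P.tensor f g) = Q.tensor (map a b f) (map c d g)
  map_swap : ∀ m n : ℕ, map (m + n) (n + m) (P.swap m n) = Q.swap m n

/-! ## The linear prop generated by a prop in sets -/

section FreeVect

variable (k : Type u) [Field k]

/-- The bilinear extension `⟨α⟩ × ⟨β⟩ → ⟨γ⟩` of a map `α × β → γ`. -/
noncomputable def bilinExt {α β γ : Type*} (op : α → β → γ) :
    (α →₀ k) →ₗ[k] (β →₀ k) →ₗ[k] (γ →₀ k) :=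
  Finsupp.linearCombination k fun a => Finsupp.lmapDomain k k (op a)

@[simp]
theorem bilinExt_single {α β γ : Type*} (op : α → β → γ) (a : α) (b : β) (x y : k) :
    bilinExt k op (Finsupp.single a x) (Finsupp.single b y) =
      Finsupp.single (op a b) (x * y) := by
  simp [bilinExt]

theorem castHom_single (H : ℕ → ℕ → Type v) {a a' b b' : ℕ} (ha : a = a') (hb : b = b')
    (f : H a b) (x : k) :
    castHom (fun n m => H n m →₀ k) ha hb (Finsupp.single f x) =
      Finsupp.single (castHom H ha hb f) x := by
  subst ha hb; rfl

theorem castHom_add (H : ℕ → ℕ → Type v) {a a' b b' : ℕ} (ha : a = a') (hb : b = b')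
    (f g : H a b →₀ k) :
    castHom (fun n m => H n m →₀ k) ha hb (f + g) =
      castHom (fun n m => H n m →₀ k) ha hb f + castHom (fun n m => H n m →₀ k) ha hb g := by
  subst ha hb; rfl

theorem castHom_zero (H : ℕ → ℕ → Type v) {a a' b b' : ℕ} (ha : a = a') (hb : b = b') :
    castHom (fun n m => H n m →₀ k) ha hb (0 : H a b →₀ k) = 0 := by
  subst ha hb; rfl

/-- The prop `⟨P⟩` in vector spaces: `⟨P⟩(n, m)` is the free vector space on the set `P(n, m)`,
and composition and tensor product are extended bilinearly. -/
noncomputable def SetPROP.linearize (P : SetPROP.{v}) : LinPROP.{u, max u v} k where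
  Hom n m := P.Hom n m →₀ k
  id n := Finsupp.single (P.id n) 1
  comp f g := bilinExt k P.comp f g
  tensor f g := bilinExt k P.tensor f g
  swap m n := Finsupp.single (P.swap m n) 1
  id_comp f := by
    induction f using Finsupp.induction_linear with
    | zero => simp
    | add f g hf hg => simp only [map_add, LinearMap.add_apply, hf, hg]
    | single a x => simp [P.id_comp]
  comp_id f := by
    induction f using Finsupp.induction_linear with
    | zero => simp
    | add f g hf hg => simp only [map_add, LinearMap.add_apply, hf, hg]
    | single a x => simp [P.comp_id]
  comp_assoc f g h := by
    induction f using Finsupp.induction_linear with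
    | zero => simp
    | add f f' hf hg => simp only [map_add, LinearMap.add_apply, hf, hg]
    | single a x =>
    induction g using Finsupp.induction_linear with
    | zero => simp
    | add f f' hf hg => simp only [map_add, LinearMap.add_apply, hf, hg]
    | single b y =>
    induction h using Finsupp.induction_linear with
    | zero => simp
    | add f f' hf hg => simp only [map_add, LinearMap.add_apply, hf, hg]
    | single c z => simp [-Finsupp.single_mul, P.comp_assoc, mul_assoc]
  tensor_id m n := by simp [P.tensor_id]
  tensor_comp f g f' g' := by
    induction f using Finsupp.induction_linear with
    | zero => simp
    | add f f' hf hg => simp only [map_add, LinearMap.add_apply, hf, hg]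
    | single a x =>
    induction g using Finsupp.induction_linear with
    | zero => simp
    | add f f' hf hg => simp only [map_add, LinearMap.add_apply, hf, hg]
    | single b y =>
    induction f' using Finsupp.induction_linear with
    | zero => simp
    | add f f' hf hg => simp only [map_add, LinearMap.add_apply, hf, hg]
    | single c z =>
    induction g' using Finsupp.induction_linear with
    | zero => simp
    | add f f' hf hg => simp only [map_add, LinearMap.add_apply, hf, hg]
    | single d t => simp [-Finsupp.single_mul, P.tensor_comp, mul_mul_mul_comm]
  id_zero_tensor f := by
    induction f using Finsupp.induction_linear with
    | zero => simp [castHom_zero]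
    | add f g hf hg => simp only [map_add, LinearMap.add_apply, castHom_add, hf, hg]
    | single a x => simp [castHom_single, P.id_zero_tensor]
  tensor_id_zero f := by
    induction f using Finsupp.induction_linear with
    | zero => simp [castHom_zero]
    | add f g hf hg => simp only [map_add, LinearMap.add_apply, castHom_add, hf, hg]
    | single a x =>
      rw [bilinExt_single, castHom_single, P.tensor_id_zero, mul_one]
  tensor_assoc f g h := by
    induction f using Finsupp.induction_linear with
    | zero => simp [castHom_zero]
    | add f f' hf hg => simp only [map_add, LinearMap.add_apply, castHom_add, hf, hg]
    | single a x =>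
    induction g using Finsupp.induction_linear with
    | zero => simp [castHom_zero]
    | add f f' hf hg => simp only [map_add, LinearMap.add_apply, castHom_add, hf, hg]
    | single b y =>
    induction h using Finsupp.induction_linear with
    | zero => simp [castHom_zero]
    | add f f' hf hg => simp only [map_add, LinearMap.add_apply, castHom_add, hf, hg]
    | single c z => simp [-Finsupp.single_mul, castHom_single, P.tensor_assoc, mul_assoc]
  swap_natural f g := by
    induction f using Finsupp.induction_linear with
    | zero => simp
    | add f f' hf hg => simp only [map_add, LinearMap.add_apply, hf, hg]
    | single a x =>
    induction g using Finsupp.induction_linear with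
    | zero => simp
    | add f f' hf hg => simp only [map_add, LinearMap.add_apply, hf, hg]
    | single b y => simp [-Finsupp.single_mul, P.swap_natural, mul_comm]
  swap_swap m n := by simp [P.swap_swap]
  swap_add a b c := by
    simp only [bilinExt_single, castHom_single, mul_one]
    rw [P.swap_add]
  add_comp f f' g := by simp
  smul_comp s f g := by simp
  comp_add f g g' := by simp
  comp_smul s f g := by simp
  add_tensor f f' g := by simp
  smul_tensor s f g := by simp
  tensor_add f g g' := by simp
  tensor_smul s f g := by simp

end FreeVect

/-! ## Props presented by generators and relations -/

/-- Formal string diagrams with `n` inputs and `m` outputs, built from vertices of the signature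
`G`, where `G n m` is the set of vertices with `n` inputs and `m` outputs. -/
inductive PropTerm (G : ℕ → ℕ → Type u) : ℕ → ℕ → Type u
  | gen {n m : ℕ} (g : G n m) : PropTerm G n m
  | id (n : ℕ) : PropTerm G n n
  | comp {a b c : ℕ} (f : PropTerm G a b) (g : PropTerm G b c) : PropTerm G a c
  | tensor {a b c d : ℕ} (f : PropTerm G a b) (g : PropTerm G c d) :
      PropTerm G (a + c) (b + d)
  | swap (m n : ℕ) : PropTerm G (m + n) (n + m)

/-- The smallest congruence on formal diagrams which contains the relations `R` and makes the
axioms of a prop hold. -/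
inductive PropCongr {G : ℕ → ℕ → Type u}
    (R : ∀ n m : ℕ, PropTerm G n m → PropTerm G n m → Prop) :
    ∀ {n m : ℕ}, PropTerm G n m → PropTerm G n m → Prop
  | rel {n m : ℕ} {f g : PropTerm G n m} (h : R n m f g) : PropCongr R f g
  | refl {n m : ℕ} (f : PropTerm G n m) : PropCongr R f f
  | symm {n m : ℕ} {f g : PropTerm G n m} (h : PropCongr R f g) : PropCongr R g f
  | trans {n m : ℕ} {f g h : PropTerm G n m} (h₁ : PropCongr R f g) (h₂ : PropCongr R g h) :
      PropCongr R f h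
  | comp {a b c : ℕ} {f f' : PropTerm G a b} {g g' : PropTerm G b c}
      (h₁ : PropCongr R f f') (h₂ : PropCongr R g g') : PropCongr R (f.comp g) (f'.comp g')
  | tensor {a b c d : ℕ} {f f' : PropTerm G a b} {g g' : PropTerm G c d}
      (h₁ : PropCongr R f f') (h₂ : PropCongr R g g') :
      PropCongr R (f.tensor g) (f'.tensor g')
  | id_comp {a b : ℕ} (f : PropTerm G a b) : PropCongr R ((PropTerm.id a).comp f) f
  | comp_id {a b : ℕ} (f : PropTerm G a b) : PropCongr R (f.comp (PropTerm.id b)) f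
  | comp_assoc {a b c d : ℕ} (f : PropTerm G a b) (g : PropTerm G b c) (h : PropTerm G c d) :
      PropCongr R ((f.comp g).comp h) (f.comp (g.comp h))
  | tensor_id (m n : ℕ) :
      PropCongr R ((PropTerm.id m).tensor (PropTerm.id n)) (PropTerm.id (m + n))
  | tensor_comp {a b c a' b' c' : ℕ} (f : PropTerm G a b) (g : PropTerm G b c)
      (f' : PropTerm G a' b') (g' : PropTerm G b' c') :
      PropCongr R ((f.comp g).tensor (f'.comp g')) ((f.tensor f').comp (g.tensor g'))
  | id_zero_tensor {a b : ℕ} (f : PropTerm G a b) :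
      PropCongr R (castHom (PropTerm G) (Nat.zero_add a) (Nat.zero_add b)
        ((PropTerm.id 0).tensor f)) f
  | tensor_id_zero {a b : ℕ} (f : PropTerm G a b) :
      PropCongr R (castHom (PropTerm G) (Nat.add_zero a) (Nat.add_zero b)
        (f.tensor (PropTerm.id 0))) f
  | tensor_assoc {a b c a' b' c' : ℕ} (f : PropTerm G a a') (g : PropTerm G b b')
      (h : PropTerm G c c') :
      PropCongr R (castHom (PropTerm G) (Nat.add_assoc a b c) (Nat.add_assoc a' b' c')
        ((f.tensor g).tensor h)) (f.tensor (g.tensor h))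
  | swap_natural {a b c d : ℕ} (f : PropTerm G a b) (g : PropTerm G c d) :
      PropCongr R ((f.tensor g).comp (PropTerm.swap b d))
        ((PropTerm.swap a c).comp (g.tensor f))
  | swap_swap (m n : ℕ) :
      PropCongr R ((PropTerm.swap m n).comp (PropTerm.swap n m)) (PropTerm.id (m + n))
  | swap_add (a b c : ℕ) :
      PropCongr R (PropTerm.swap a (b + c))
        ((castHom (PropTerm G) (Nat.add_assoc a b c) (Nat.add_assoc b a c)
            ((PropTerm.swap a b).tensor (PropTerm.id c))).comp
          (castHom (PropTerm G) rfl (Nat.add_assoc b c a).symm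
            ((PropTerm.id b).tensor (PropTerm.swap a c))))

/-- Formal diagrams form a setoid under the congruence generated by the relations. -/
def propSetoid {G : ℕ → ℕ → Type u} (R : ∀ n m : ℕ, PropTerm G n m → PropTerm G n m → Prop)
    (n m : ℕ) : Setoid (PropTerm G n m) where
  r := PropCongr R
  iseqv := ⟨PropCongr.refl, PropCongr.symm, PropCongr.trans⟩

theorem castHom_mk {G : ℕ → ℕ → Type u}
    (R : ∀ n m : ℕ, PropTerm G n m → PropTerm G n m → Prop) {a a' b b' : ℕ}
    (ha : a = a') (hb : b = b') (f : PropTerm G a b) :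
    castHom (fun n m => Quotient (propSetoid R n m)) ha hb (Quotient.mk _ f) =
      Quotient.mk (propSetoid R a' b') (castHom (PropTerm G) ha hb f) := by
  subst ha hb; rfl

/-- The prop in sets presented by the generators `G` and the relations `R`: the free prop on `G`
modulo the smallest congruence of props containing `R`. -/
def SetPROP.presented (G : ℕ → ℕ → Type u)
    (R : ∀ n m : ℕ, PropTerm G n m → PropTerm G n m → Prop) : SetPROP.{u} where
  Hom n m := Quotient (propSetoid R n m)
  id n := Quotient.mk _ (PropTerm.id n)
  comp := Quotient.map₂ PropTerm.comp fun _ _ h₁ _ _ h₂ => PropCongr.comp h₁ h₂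
  tensor := Quotient.map₂ PropTerm.tensor fun _ _ h₁ _ _ h₂ => PropCongr.tensor h₁ h₂
  swap m n := Quotient.mk _ (PropTerm.swap m n)
  id_comp f := by
    induction f using Quotient.ind
    exact Quotient.sound (PropCongr.id_comp _)
  comp_id f := by
    induction f using Quotient.ind
    exact Quotient.sound (PropCongr.comp_id _)
  comp_assoc f g h := by
    induction f using Quotient.ind
    induction g using Quotient.ind
    induction h using Quotient.ind
    exact Quotient.sound (PropCongr.comp_assoc _ _ _)
  tensor_id m n := Quotient.sound (PropCongr.tensor_id m n)
  tensor_comp f g f' g' := by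
    induction f using Quotient.ind
    induction g using Quotient.ind
    induction f' using Quotient.ind
    induction g' using Quotient.ind
    exact Quotient.sound (PropCongr.tensor_comp _ _ _ _)
  id_zero_tensor f := by
    induction f using Quotient.ind
    exact (castHom_mk R _ _ _).trans (Quotient.sound (PropCongr.id_zero_tensor _))
  tensor_id_zero f := by
    induction f using Quotient.ind
    exact (castHom_mk R _ _ _).trans (Quotient.sound (PropCongr.tensor_id_zero _))
  tensor_assoc f g h := by
    induction f using Quotient.ind
    induction g using Quotient.ind
    induction h using Quotient.ind
    exact (castHom_mk R _ _ _).trans (Quotient.sound (PropCongr.tensor_assoc _ _ _))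
  swap_natural f g := by
    induction f using Quotient.ind
    induction g using Quotient.ind
    exact Quotient.sound (PropCongr.swap_natural _ _)
  swap_swap m n := Quotient.sound (PropCongr.swap_swap m n)
  swap_add a b c := by
    erw [castHom_mk R, castHom_mk R]
    exact Quotient.sound (PropCongr.swap_add a b c)

/-! ## The prop Boole -/

/-- The generating vertices of the prop Boole, with their numbers of inputs and outputs. -/
inductive BooleGen : ℕ → ℕ → Type
  | union : BooleGen 2 1
  | inter : BooleGen 2 1
  | compl : BooleGen 1 1
  | coprod : BooleGen 1 2
  | empty : BooleGen 0 1
  | total : BooleGen 0 1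
  | ev : BooleGen 1 0

namespace BooleTerm

/-- Formal diagrams in the generators of Boole. -/
abbrev Diag : ℕ → ℕ → Type := PropTerm BooleGen

/-- The identity on one strand. -/
abbrev I : Diag 1 1 := PropTerm.id 1
/-- The crossing of two strands. -/
abbrev S : Diag 2 2 := PropTerm.swap 1 1
abbrev union : Diag 2 1 := PropTerm.gen BooleGen.union
abbrev inter : Diag 2 1 := PropTerm.gen BooleGen.inter
abbrev compl : Diag 1 1 := PropTerm.gen BooleGen.compl
abbrev coprod : Diag 1 2 := PropTerm.gen BooleGen.coprod
abbrev empty : Diag 0 1 := PropTerm.gen BooleGen.empty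
abbrev total : Diag 0 1 := PropTerm.gen BooleGen.total
abbrev ev : Diag 1 0 := PropTerm.gen BooleGen.ev

/-- First `f`, then `g`. -/
abbrev seq {a b c : ℕ} (f : Diag a b) (g : Diag b c) : Diag a c := PropTerm.comp f g
/-- `f` next to `g`. -/
abbrev par {a b c d : ℕ} (f : Diag a b) (g : Diag c d) : Diag (a + c) (b + d) :=
  PropTerm.tensor f g

end BooleTerm

open BooleTerm in
/-- The defining relations of the prop Boole. -/
inductive BooleRel : ∀ n m : ℕ, Diag n m → Diag n m → Prop
  | union_comm : BooleRel 2 1 (seq S union) union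
  | inter_comm : BooleRel 2 1 (seq S inter) inter
  | union_assoc : BooleRel 3 1 (seq (par union I :) union) (seq (par I union :) union)
  | inter_assoc : BooleRel 3 1 (seq (par inter I :) inter) (seq (par I inter :) inter)
  | inter_union_distrib : BooleRel 3 1
      (seq (par I union :) inter)
      (seq (par (par coprod I) I :) (seq (par (par I S) I :) (seq (par inter inter :) union)))
  | union_inter_distrib : BooleRel 3 1
      (seq (par I inter :) union)
      (seq (par (par coprod I) I :) (seq (par (par I S) I :) (seq (par union union :) inter)))
  | union_empty : BooleRel 1 1 (seq (par I empty :) union) I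
  | inter_total : BooleRel 1 1 (seq (par I total :) inter) I
  | inter_compl : BooleRel 1 1 (seq coprod (seq (par I compl :) inter)) (seq ev empty)
  | union_compl : BooleRel 1 1 (seq coprod (seq (par I compl :) union)) (seq ev total)
  | inter_absorb : BooleRel 2 1 (seq (par coprod I :) (seq (par I union :) inter)) (par I ev :)
  | union_absorb : BooleRel 2 1 (seq (par coprod I :) (seq (par I inter :) union)) (par I ev :)
  | coassoc : BooleRel 1 3 (seq coprod (par coprod I :)) (seq coprod (par I coprod :))
  | cocomm : BooleRel 1 2 (seq coprod S) coprod

/-- The prop Boole in sets. -/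
def Boole : SetPROP.{0} := SetPROP.presented BooleGen BooleRel

/-- The generating vertices, as morphisms of the prop Boole. -/
def Boole.gen {n m : ℕ} (g : BooleGen n m) : Boole.Hom n m :=
  Quotient.mk _ (PropTerm.gen g)

/-! ## The endomorphism prop of a vector space -/

section EndProp

variable (k : Type u) [Field k] (V : Type v) [AddCommGroup V] [Module k V]

variable {k V} in
/-- Concatenation of tensors, `V^{⊗m} × V^{⊗n} → V^{⊗(m+n)}`. -/
noncomputable def tmulPow {m n : ℕ} (x : ⨂[k]^m V) (y : ⨂[k]^n V) : ⨂[k]^(m + n) V :=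
  TensorPower.mulEquiv (x ⊗ₜ[k] y)

variable {k V} in
theorem tmulPow_ext {m n : ℕ} {W : Type*} [AddCommGroup W] [Module k W]
    {f g : (⨂[k]^(m + n) V) →ₗ[k] W}
    (h : ∀ (x : ⨂[k]^m V) (y : ⨂[k]^n V), f (tmulPow x y) = g (tmulPow x y)) : f = g := by
  have : f ∘ₗ (TensorPower.mulEquiv (R := k) (M := V) (n := m) (m := n)).toLinearMap =
      g ∘ₗ (TensorPower.mulEquiv (R := k) (M := V) (n := m) (m := n)).toLinearMap :=
    TensorProduct.ext' h
  ext1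
  ext z
  obtain ⟨t, ht⟩ := (TensorPower.mulEquiv (R := k) (M := V) (n := m) (m := n)).surjective
    (PiTensorProduct.tprod k z)
  have h2 := LinearMap.congr_fun this t
  simp only [LinearMap.comp_apply, LinearEquiv.coe_coe, ht] at h2
  simpa using h2

variable {k V} in
/-- The linear map `f ⊗ g : V^{⊗(a+c)} → V^{⊗(b+d)}`. -/
noncomputable def tensorPow {a b c d : ℕ} (f : (⨂[k]^a V) →ₗ[k] ⨂[k]^b V)
    (g : (⨂[k]^c V) →ₗ[k] ⨂[k]^d V) : (⨂[k]^(a + c) V) →ₗ[k] ⨂[k]^(b + d) V :=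
  TensorPower.mulEquiv.toLinearMap ∘ₗ TensorProduct.map f g ∘ₗ
    TensorPower.mulEquiv.symm.toLinearMap

/-- The linear map `V^{⊗(m+n)} → V^{⊗(n+m)}` sending `x ⊗ y` to `y ⊗ x`. -/
noncomputable def swapPow (m n : ℕ) : (⨂[k]^(m + n) V) →ₗ[k] ⨂[k]^(n + m) V :=
  TensorPower.mulEquiv.toLinearMap ∘ₗ (TensorProduct.comm k (⨂[k]^m V) (⨂[k]^n V)).toLinearMap ∘ₗ
    TensorPower.mulEquiv.symm.toLinearMap

variable {k V}

@[simp]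
theorem tensorPow_tmulPow {a b c d : ℕ} (f : (⨂[k]^a V) →ₗ[k] ⨂[k]^b V)
    (g : (⨂[k]^c V) →ₗ[k] ⨂[k]^d V) (x : ⨂[k]^a V) (y : ⨂[k]^c V) :
    tensorPow f g (tmulPow x y) = tmulPow (f x) (g y) := by
  simp [tensorPow, tmulPow]

@[simp]
theorem swapPow_tmulPow {m n : ℕ} (x : ⨂[k]^m V) (y : ⨂[k]^n V) :
    swapPow k V m n (tmulPow x y) = tmulPow y x := by
  simp [swapPow, tmulPow]

theorem tmulPow_assoc {a b c : ℕ} (x : ⨂[k]^a V) (y : ⨂[k]^b V) (z : ⨂[k]^c V) :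
    TensorPower.cast k V (Nat.add_assoc a b c) (tmulPow (tmulPow x y) z) =
      tmulPow x (tmulPow y z) :=
  TensorPower.mul_assoc x y z

theorem tmulPow_assoc' {a b c : ℕ} (x : ⨂[k]^a V) (y : ⨂[k]^b V) (z : ⨂[k]^c V) :
    TensorPower.cast k V (Nat.add_assoc a b c).symm (tmulPow x (tmulPow y z)) =
      tmulPow (tmulPow x y) z := by
  rw [← tmulPow_assoc]; simp

theorem castHom_pow {a a' b b' : ℕ} (ha : a = a') (hb : b = b')
    (f : (⨂[k]^a V) →ₗ[k] ⨂[k]^b V) (x : ⨂[k]^a' V) :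
    castHom (fun n m => (⨂[k]^n V) →ₗ[k] ⨂[k]^m V) ha hb f x =
      TensorPower.cast k V hb (f (TensorPower.cast k V ha.symm x)) := by
  subst ha hb; simp [castHom]

theorem castHom_pow_tensor_assoc {a b c a' b' : ℕ} (F : (⨂[k]^(a + b + c) V) →ₗ[k] ⨂[k]^a' V)
    (h : a' = b') (x : ⨂[k]^a V) (y : ⨂[k]^b V) (z : ⨂[k]^c V) :
    castHom (fun n m => (⨂[k]^n V) →ₗ[k] ⨂[k]^m V) (Nat.add_assoc a b c) h F
      (tmulPow x (tmulPow y z)) = TensorPower.cast k V h (F (tmulPow (tmulPow x y) z)) := by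
  rw [castHom_pow, tmulPow_assoc']

theorem tmulPow_ext₃ {a b c : ℕ} {W : Type*} [AddCommGroup W] [Module k W]
    {f g : (⨂[k]^(a + (b + c)) V) →ₗ[k] W}
    (h : ∀ (x : ⨂[k]^a V) (y : ⨂[k]^b V) (z : ⨂[k]^c V),
      f (tmulPow x (tmulPow y z)) = g (tmulPow x (tmulPow y z))) : f = g := by
  refine tmulPow_ext fun x y => ?_
  have : f ∘ₗ TensorPower.mulEquiv.toLinearMap ∘ₗ TensorProduct.mk k _ _ x =
      g ∘ₗ TensorPower.mulEquiv.toLinearMap ∘ₗ TensorProduct.mk k _ _ x :=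
    tmulPow_ext fun y z => h x y z
  exact LinearMap.congr_fun this y

theorem one_tmulPow {a : ℕ} (x : ⨂[k]^a V) :
    TensorPower.cast k V (Nat.zero_add a) (tmulPow (PiTensorProduct.tprod k Fin.elim0) x) = x :=
  TensorPower.one_mul x

theorem tmulPow_one {a : ℕ} (x : ⨂[k]^a V) :
    TensorPower.cast k V (Nat.add_zero a) (tmulPow x (PiTensorProduct.tprod k Fin.elim0)) = x :=
  TensorPower.mul_one x

theorem cast_symm_eq_one_tmulPow {a : ℕ} (x : ⨂[k]^a V) :
    TensorPower.cast k V (Nat.zero_add a).symm x =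
      tmulPow (PiTensorProduct.tprod k Fin.elim0) x := by
  conv_lhs => rw [← one_tmulPow x]
  simp

theorem cast_symm_eq_tmulPow_one {a : ℕ} (x : ⨂[k]^a V) :
    TensorPower.cast k V (Nat.add_zero a).symm x =
      tmulPow x (PiTensorProduct.tprod k Fin.elim0) := by
  conv_lhs => rw [← tmulPow_one x]
  rw [TensorPower.cast_cast, TensorPower.cast_refl]; rfl

variable (k V)

/-- The endomorphism prop of `V`: morphisms from `n` to `m` are the linear maps
`V^{⊗n} → V^{⊗m}`. -/
noncomputable def EndPROP : LinPROP.{u, max u v} k where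
  Hom n m := (⨂[k]^n V) →ₗ[k] ⨂[k]^m V
  id n := LinearMap.id
  comp f g := g ∘ₗ f
  tensor := tensorPow
  swap := swapPow k V
  id_comp f := rfl
  comp_id f := rfl
  comp_assoc f g h := rfl
  tensor_id m n := tmulPow_ext fun x y => by simp
  tensor_comp f g f' g' := tmulPow_ext fun x y => by simp
  id_zero_tensor f := LinearMap.ext fun x => by
    rw [castHom_pow, cast_symm_eq_one_tmulPow, tensorPow_tmulPow]
    exact one_tmulPow (f x)
  tensor_id_zero {a b} f := LinearMap.ext fun x => by
    rw [castHom_pow, cast_symm_eq_tmulPow_one x, tensorPow_tmulPow (a := a) (c := 0)]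
    exact tmulPow_one (f x)
  tensor_assoc f g h := tmulPow_ext₃ fun x y z => by
    rw [castHom_pow_tensor_assoc _ (Nat.add_assoc _ _ _)]
    simp [tmulPow_assoc]
  swap_natural f g := tmulPow_ext fun x y => by simp
  swap_swap m n := tmulPow_ext fun x y => by simp
  swap_add a b c := tmulPow_ext₃ fun x y z => by
    rw [LinearMap.comp_apply, castHom_pow_tensor_assoc _ (Nat.add_assoc b a c)]
    simp [tmulPow_assoc, castHom_pow, tmulPow_assoc']
  add_comp f f' g := by simp [LinearMap.comp_add]
  smul_comp s f g := by simp [LinearMap.comp_smul]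
  comp_add f g g' := by simp [LinearMap.add_comp]
  comp_smul s f g := by simp [LinearMap.smul_comp]
  add_tensor f f' g := tmulPow_ext fun x y => by
    rw [tensorPow_tmulPow]; simp [tmulPow, tensorPow, TensorProduct.add_tmul]
  smul_tensor s f g := tmulPow_ext fun x y => by
    rw [tensorPow_tmulPow]; simp [tmulPow, tensorPow, ← TensorProduct.smul_tmul']
  tensor_add f g g' := tmulPow_ext fun x y => by
    rw [tensorPow_tmulPow]; simp [tmulPow, tensorPow, TensorProduct.tmul_add]
  tensor_smul s f g := tmulPow_ext fun x y => by
    rw [tensorPow_tmulPow]; simp [tmulPow, tensorPow]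

end EndProp

/-- A `P`-algebra structure on the vector space `V`: a morphism of props `P ⟶ End_V`. -/
abbrev LinPROP.AlgebraOn {k : Type u} [Field k] (P : LinPROP.{u, w} k) (V : Type v)
    [AddCommGroup V] [Module k V] :=
  LinPROP.Morphism P (EndPROP k V)

/-! ## Linear Boolean algebras -/

/-- The data of a linear Boolean algebra on a vector space. -/
@[ext]
structure LinearBooleanOps (k : Type u) [Field k] (V : Type v) [AddCommGroup V] [Module k V] where
  union : V ⊗[k] V →ₗ[k] V
  inter : V ⊗[k] V →ₗ[k] V
  compl : V →ₗ[k] V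
  /-- the total map -/
  T : k →ₗ[k] V
  /-- the empty map -/
  E : k →ₗ[k] V
  coprod : V →ₗ[k] V ⊗[k] V
  ev : V →ₗ[k] k

open TensorProduct in
/-- A linear Boolean algebra structure on a vector space. -/
@[ext]
structure LinearBooleanAlgebra (k : Type u) [Field k] (V : Type v) [AddCommGroup V] [Module k V]
    extends LinearBooleanOps k V where
  union_comm : union ∘ₗ (TensorProduct.comm k V V).toLinearMap = union
  inter_comm : inter ∘ₗ (TensorProduct.comm k V V).toLinearMap = inter
  union_assoc : union ∘ₗ map union LinearMap.id =
    union ∘ₗ map LinearMap.id union ∘ₗ (TensorProduct.assoc k V V V).toLinearMap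
  inter_assoc : inter ∘ₗ map inter LinearMap.id =
    inter ∘ₗ map LinearMap.id inter ∘ₗ (TensorProduct.assoc k V V V).toLinearMap
  /-- `tensorTensorTensorComm` is `I ⊗ S ⊗ I`, sending `(a ⊗ b) ⊗ (c ⊗ d)` to
  `(a ⊗ c) ⊗ (b ⊗ d)`. -/
  inter_union_distrib : inter ∘ₗ map LinearMap.id union =
    union ∘ₗ map inter inter ∘ₗ (tensorTensorTensorComm k V V V V).toLinearMap ∘ₗ
      map coprod LinearMap.id
  union_inter_distrib : union ∘ₗ map LinearMap.id inter =
    inter ∘ₗ map union union ∘ₗ (tensorTensorTensorComm k V V V V).toLinearMap ∘ₗ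
      map coprod LinearMap.id
  union_empty : union ∘ₗ map LinearMap.id E = (TensorProduct.rid k V).toLinearMap
  inter_total : inter ∘ₗ map LinearMap.id T = (TensorProduct.rid k V).toLinearMap
  inter_compl : inter ∘ₗ map LinearMap.id compl ∘ₗ coprod = E ∘ₗ ev
  union_compl : union ∘ₗ map LinearMap.id compl ∘ₗ coprod = T ∘ₗ ev
  inter_absorb : inter ∘ₗ map LinearMap.id union ∘ₗ (TensorProduct.assoc k V V V).toLinearMap ∘ₗ
    map coprod LinearMap.id = (TensorProduct.rid k V).toLinearMap ∘ₗ map LinearMap.id ev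
  union_absorb : union ∘ₗ map LinearMap.id inter ∘ₗ (TensorProduct.assoc k V V V).toLinearMap ∘ₗ
    map coprod LinearMap.id = (TensorProduct.rid k V).toLinearMap ∘ₗ map LinearMap.id ev
  coassoc : (TensorProduct.assoc k V V V).toLinearMap ∘ₗ map coprod LinearMap.id ∘ₗ coprod =
    map LinearMap.id coprod ∘ₗ coprod
  cocomm : (TensorProduct.comm k V V).toLinearMap ∘ₗ coprod = coprod

/-! ## The operations defined by an algebra over `⟨Boole⟩` -/

section Operations

variable (k : Type u) [Field k] (V : Type v) [AddCommGroup V] [Module k V]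

/-- The canonical isomorphism `V^{⊗0} ≃ k`. -/
noncomputable def pow0 : (⨂[k]^0 V) ≃ₗ[k] k :=
  PiTensorProduct.isEmptyEquiv (Fin 0)

/-- The canonical isomorphism `V^{⊗1} ≃ V`. -/
noncomputable def pow1 : (⨂[k]^1 V) ≃ₗ[k] V :=
  PiTensorProduct.subsingletonEquiv (0 : Fin 1)

/-- The canonical isomorphism `V^{⊗2} ≃ V ⊗ V`. -/
noncomputable def pow2 : (⨂[k]^2 V) ≃ₗ[k] V ⊗[k] V :=
  (TensorPower.mulEquiv (R := k) (M := V) (n := 1) (m := 1)).symm ≪≫ₗ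
    TensorProduct.congr (pow1 k V) (pow1 k V)

variable {k V}

/-- The linear map `V^{⊗n} → V^{⊗m}` by which a generating vertex of Boole acts on a
`⟨Boole⟩`-algebra `V`. -/
noncomputable def booleAct (r : (Boole.linearize k).AlgebraOn V) {n m : ℕ} (g : BooleGen n m) :
    (⨂[k]^n V) →ₗ[k] ⨂[k]^m V :=
  r.map n m (Finsupp.single (Boole.gen g) (1 : k))

/-- The images of the generating vertices of Boole in a `⟨Boole⟩`-algebra `V`, as linear maps
between `k`, `V` and `V ⊗ V`. -/
noncomputable def booleOps (r : (Boole.linearize k).AlgebraOn V) : LinearBooleanOps k V where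
  union := (pow1 k V).toLinearMap ∘ₗ booleAct r BooleGen.union ∘ₗ (pow2 k V).symm.toLinearMap
  inter := (pow1 k V).toLinearMap ∘ₗ booleAct r BooleGen.inter ∘ₗ (pow2 k V).symm.toLinearMap
  compl := (pow1 k V).toLinearMap ∘ₗ booleAct r BooleGen.compl ∘ₗ (pow1 k V).symm.toLinearMap
  T := (pow1 k V).toLinearMap ∘ₗ booleAct r BooleGen.total ∘ₗ (pow0 k V).symm.toLinearMap
  E := (pow1 k V).toLinearMap ∘ₗ booleAct r BooleGen.empty ∘ₗ (pow0 k V).symm.toLinearMap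
  coprod := (pow2 k V).toLinearMap ∘ₗ booleAct r BooleGen.coprod ∘ₗ (pow1 k V).symm.toLinearMap
  ev := (pow0 k V).toLinearMap ∘ₗ booleAct r BooleGen.ev ∘ₗ (pow1 k V).symm.toLinearMap

end Operations

/-! Two universal properties reduce the theorem to a statement about vertices. The space `⟨P⟩(n, m)`
has the set `P(n, m)` as a basis and its operations are bilinear, so a linear prop morphism out of
`⟨P⟩` amounts to a functor on `P` (`SetPROP.linearizeLift`, `SetPROP.linearize_morphism_ext`). For a
presented prop, such a functor amounts to a choice of values for the vertices satisfying the
relations: the generating congruence contains only the relations, their closure under equivalence,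
composition and tensor, and the prop axioms, all of which hold in the target (`PropCongr.eval_eq`).
Hence a `⟨Boole⟩`-algebra on `V` is a family of linear maps between tensor powers, one for each
vertex, that satisfies `BooleRel` in `End_V`.

It remains to compare these maps with operations on `k`, `V` and `V ⊗ V`. Conjugation by `pow0`,
`pow1`, `pow2` is a bijection on the data. For the axioms, `Realizes e e' F f` says that `F` reads
as `f` in the coordinates `e`, `e'`. It is stable under composition, tensor product and symmetry, so
each side of a relation realizes the corresponding side of an axiom, and `Realizes.eq_iff` makes the
two equations equivalent.

The delicate point is strictness: `V^{⊗3}` is a single object of `End_V`, but it has coordinates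
both in `(V ⊗ V) ⊗ V` and in `V ⊗ (V ⊗ V)`. The identity map realizes the associator between them,
and likewise the right unitor between `V ⊗ k` and `V`. This is how `assoc`, `rid` and
`tensorTensorTensorComm` enter the linear axioms although the diagrams show no such maps. -/

/-! ## The universal property of a presented prop -/

section Presented

variable {G : ℕ → ℕ → Type w}

/-- The value of a formal diagram in a prop, given the values of the vertices. -/
def PropTerm.eval (Q : SetPROP.{v}) (act : ∀ n m, G n m → Q.Hom n m) :
    ∀ {n m : ℕ}, PropTerm G n m → Q.Hom n m
  | _, _, .gen g => act _ _ g
  | _, _, .id n => Q.id n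
  | _, _, .comp f g => Q.comp (f.eval Q act) (g.eval Q act)
  | _, _, .tensor f g => Q.tensor (f.eval Q act) (g.eval Q act)
  | _, _, .swap m n => Q.swap m n

theorem PropTerm.eval_castHom (Q : SetPROP.{v}) (act : ∀ n m, G n m → Q.Hom n m)
    {a a' b b' : ℕ} (ha : a = a') (hb : b = b') (f : PropTerm G a b) :
    (castHom (PropTerm G) ha hb f).eval Q act = castHom Q.Hom ha hb (f.eval Q act) := by
  subst ha hb; rfl

/-- Congruent diagrams have the same value in every prop in which the relations hold. -/
theorem PropCongr.eval_eq {R : ∀ n m : ℕ, PropTerm G n m → PropTerm G n m → Prop}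
    (Q : SetPROP.{v}) (act : ∀ n m, G n m → Q.Hom n m)
    (h : ∀ n m f g, R n m f g → f.eval Q act = g.eval Q act) {n m : ℕ} {f g : PropTerm G n m}
    (hfg : PropCongr R f g) : f.eval Q act = g.eval Q act := by
  -- Every constructor of the congruence is a given relation, a property of equality, or a prop
  -- axiom valid in `Q`. Only the axioms with transports need `PropTerm.eval_castHom`.
  induction hfg with
  | rel hr => exact h _ _ _ _ hr
  | refl f => rfl
  | symm _ ih => exact ih.symm
  | trans _ _ ih₁ ih₂ => exact ih₁.trans ih₂
  | comp _ _ ih₁ ih₂ => exact congrArg₂ Q.comp ih₁ ih₂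
  | tensor _ _ ih₁ ih₂ => exact congrArg₂ Q.tensor ih₁ ih₂
  | id_comp f => exact Q.id_comp _
  | comp_id f => exact Q.comp_id _
  | comp_assoc f g h => exact Q.comp_assoc _ _ _
  | tensor_id m n => exact Q.tensor_id m n
  | tensor_comp f g f' g' => exact Q.tensor_comp _ _ _ _
  | id_zero_tensor f => exact (PropTerm.eval_castHom Q act _ _ _).trans (Q.id_zero_tensor _)
  | tensor_id_zero f => exact (PropTerm.eval_castHom Q act _ _ _).trans (Q.tensor_id_zero _)
  | tensor_assoc f g h =>
    exact (PropTerm.eval_castHom Q act _ _ _).trans (Q.tensor_assoc _ _ _)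
  | swap_natural f g => exact Q.swap_natural _ _
  | swap_swap m n => exact Q.swap_swap m n
  | swap_add a b c =>
    refine (Q.swap_add a b c).trans ?_
    simp only [PropTerm.eval, PropTerm.eval_castHom]

variable {k : Type u} [Field k] {R : ∀ n m : ℕ, PropTerm G n m → PropTerm G n m → Prop}
  {Q : LinPROP.{u, v} k}

/-- The value of a morphism of the presented prop, in a prop in which the relations hold. -/
def SetPROP.presentedEval (Q : SetPROP.{v}) (act : ∀ n m, G n m → Q.Hom n m)
    (h : ∀ n m f g, R n m f g → f.eval Q act = g.eval Q act) (n m : ℕ) :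
    (SetPROP.presented G R).Hom n m → Q.Hom n m :=
  Quotient.lift (PropTerm.eval Q act) fun _ _ hfg => PropCongr.eval_eq Q act h hfg

/-- A morphism from a linearized prop is determined by its values on the basis. -/
theorem SetPROP.linearize_morphism_ext {P : SetPROP.{w}} {r s : (P.linearize k).Morphism Q}
    (h : ∀ n m (f : P.Hom n m),
      r.map n m (Finsupp.single f (1 : k)) = s.map n m (Finsupp.single f (1 : k))) : r = s := by
  ext n m x
  have : (r.map n m : (P.Hom n m →₀ k) →ₗ[k] Q.Hom n m) = s.map n m :=
    Finsupp.lhom_ext' fun f => LinearMap.ext_ring (h n m f)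
  exact LinearMap.congr_fun this x

/-- The linear extension of a functor from a prop in sets to a prop in vector spaces. -/
noncomputable def SetPROP.linearizeLift {P : SetPROP.{w}} (φ : ∀ n m, P.Hom n m → Q.Hom n m)
    (hid : ∀ n, φ n n (P.id n) = Q.id n)
    (hcomp : ∀ {a b c : ℕ} (f : P.Hom a b) (g : P.Hom b c),
      φ a c (P.comp f g) = Q.comp (φ a b f) (φ b c g))
    (htensor : ∀ {a b c d : ℕ} (f : P.Hom a b) (g : P.Hom c d),
      φ (a + c) (b + d) (P.tensor f g) = Q.tensor (φ a b f) (φ c d g))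
    (hswap : ∀ m n, φ (m + n) (n + m) (P.swap m n) = Q.swap m n) :
    (P.linearize k).Morphism Q where
  map n m := (Finsupp.linearCombination k (φ n m) : (P.Hom n m →₀ k) →ₗ[k] Q.Hom n m)
  map_id n := (Finsupp.linearCombination_single k _ _).trans (by rw [one_smul, hid])
  map_comp {a b c} f g := by
    -- Both sides are bilinear in `f` and `g`, so agreement on basis vectors suffices, where it is
    -- `hcomp`. `C` packages the composition of `Q` as a bilinear map.
    let C : Q.Hom a b →ₗ[k] Q.Hom b c →ₗ[k] Q.Hom a c :=
      LinearMap.mk₂ k Q.comp Q.add_comp Q.smul_comp Q.comp_add Q.comp_smul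
    have : (bilinExt k P.comp).compr₂ (Finsupp.linearCombination k (φ a c)) =
        C.compl₁₂ (Finsupp.linearCombination k (φ a b)) (Finsupp.linearCombination k (φ b c)) := by
      ext f g
      simp [C, hcomp]
    exact LinearMap.congr_fun₂ this f g
  map_tensor {a b c d} f g := by
    let C : Q.Hom a b →ₗ[k] Q.Hom c d →ₗ[k] Q.Hom (a + c) (b + d) :=
      LinearMap.mk₂ k Q.tensor Q.add_tensor Q.smul_tensor Q.tensor_add Q.tensor_smul
    have : (bilinExt k P.tensor).compr₂ (Finsupp.linearCombination k (φ (a + c) (b + d))) =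
        C.compl₁₂ (Finsupp.linearCombination k (φ a b)) (Finsupp.linearCombination k (φ c d)) := by
      ext f g
      simp [C, htensor]
    exact LinearMap.congr_fun₂ this f g
  map_swap m n := (Finsupp.linearCombination_single k _ _).trans (by rw [one_smul, hswap])

/-- The morphism of props from the linear prop presented by `G` and `R` which sends the vertices
to given morphisms satisfying the relations. -/
noncomputable def SetPROP.presentedLift (act : ∀ n m, G n m → Q.Hom n m)
    (h : ∀ n m f g, R n m f g → f.eval Q.toSetPROP act = g.eval Q.toSetPROP act) :
    ((SetPROP.presented G R).linearize k).Morphism Q :=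
  SetPROP.linearizeLift (SetPROP.presentedEval Q.toSetPROP act h) (fun _ => rfl)
    -- On representatives, the operations of the quotient and `PropTerm.eval` both compute, so
    -- functoriality is definitional.
    (fun f g => by
      induction f using Quotient.ind
      induction g using Quotient.ind
      rfl)
    (fun f g => by
      induction f using Quotient.ind
      induction g using Quotient.ind
      rfl)
    (fun _ _ => rfl)

theorem SetPROP.presentedLift_gen (act : ∀ n m, G n m → Q.Hom n m)
    (h : ∀ n m f g, R n m f g → f.eval Q.toSetPROP act = g.eval Q.toSetPROP act)
    {n m : ℕ} (g : G n m) :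
    (SetPROP.presentedLift act h).map n m
      (Finsupp.single (Quotient.mk (propSetoid R n m) (PropTerm.gen g)) (1 : k)) = act n m g :=
  (Finsupp.linearCombination_single k _ _).trans (one_smul k _)

/-- The values of a morphism of props on the vertices. -/
noncomputable def LinPROP.Morphism.onGen
    (r : ((SetPROP.presented G R).linearize k).Morphism Q) (n m : ℕ) (g : G n m) : Q.Hom n m :=
  r.map n m (Finsupp.single (Quotient.mk (propSetoid R n m) (PropTerm.gen g)) (1 : k))

/-- A morphism of props sends a diagram to its value. -/
theorem LinPROP.Morphism.map_mk (r : ((SetPROP.presented G R).linearize k).Morphism Q) {n m : ℕ}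
    (t : PropTerm G n m) :
    r.map n m (Finsupp.single (Quotient.mk (propSetoid R n m) t) (1 : k)) =
      t.eval Q.toSetPROP r.onGen := by
  induction t with
  | gen g => rfl
  | id n => exact r.map_id n
  | @comp a b c f g ihf ihg =>
    rw [PropTerm.eval, ← ihf, ← ihg]
    -- The basis vector of a composite is the bilinear extension applied to two basis vectors, the
    -- coefficients multiplying to `1 * 1 = 1`.
    refine Eq.trans (congrArg _ ?_) (r.map_comp _ _)
    exact ((bilinExt_single k _ _ _ _ _).trans (by rw [mul_one]; rfl)).symm
  | @tensor a b c d f g ihf ihg =>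
    rw [PropTerm.eval, ← ihf, ← ihg]
    refine Eq.trans (congrArg _ ?_) (r.map_tensor _ _)
    exact ((bilinExt_single k _ _ _ _ _).trans (by rw [mul_one]; rfl)).symm
  | swap m n => exact r.map_swap m n

/-- Related diagrams are the same element of the presented prop, so `r` cannot distinguish them. -/
theorem LinPROP.Morphism.onGen_rel (r : ((SetPROP.presented G R).linearize k).Morphism Q)
    (n m : ℕ) (f g : PropTerm G n m) (h : R n m f g) :
    f.eval Q.toSetPROP r.onGen = g.eval Q.toSetPROP r.onGen := by
  rw [← r.map_mk, ← r.map_mk, Quotient.sound (PropCongr.rel h)]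

theorem LinPROP.Morphism.presented_ext {r s : ((SetPROP.presented G R).linearize k).Morphism Q}
    (h : r.onGen = s.onGen) : r = s := by
  refine SetPROP.linearize_morphism_ext fun n m f => ?_
  induction f using Quotient.ind
  rw [r.map_mk, s.map_mk, h]

end Presented

/-! ## Linear maps between tensor powers in coordinates -/

section Realizes

variable {k : Type u} [Field k] {V : Type v} [AddCommGroup V] [Module k V]

variable {X Y Z X' Y' : Type*} [AddCommGroup X] [Module k X] [AddCommGroup Y] [Module k Y]
  [AddCommGroup Z] [Module k Z] [AddCommGroup X'] [Module k X'] [AddCommGroup Y'] [Module k Y']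

/-- The identification `V^{⊗(m+n)} ≃ X ⊗ Y` given by `V^{⊗m} ≃ X` and `V^{⊗n} ≃ Y`. -/
noncomputable def mulPow {m n : ℕ} (e : (⨂[k]^m V) ≃ₗ[k] X) (e' : (⨂[k]^n V) ≃ₗ[k] Y) :
    (⨂[k]^(m + n) V) ≃ₗ[k] X ⊗[k] Y :=
  TensorPower.mulEquiv.symm ≪≫ₗ TensorProduct.congr e e'

@[simp]
theorem mulPow_tmulPow {m n : ℕ} (e : (⨂[k]^m V) ≃ₗ[k] X) (e' : (⨂[k]^n V) ≃ₗ[k] Y)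
    (x : ⨂[k]^m V) (y : ⨂[k]^n V) : mulPow e e' (tmulPow x y) = e x ⊗ₜ e' y := by
  simp [mulPow, tmulPow]

/-- `F` becomes `f` under the identifications `e` and `e'` of its source and its target. -/
def Realizes {n m : ℕ} (e : (⨂[k]^n V) ≃ₗ[k] X) (e' : (⨂[k]^m V) ≃ₗ[k] Y)
    (F : (⨂[k]^n V) →ₗ[k] ⨂[k]^m V) (f : X →ₗ[k] Y) : Prop :=
  e'.toLinearMap ∘ₗ F = f ∘ₗ e.toLinearMap

namespace Realizes

variable {a b c d : ℕ} {ea : (⨂[k]^a V) ≃ₗ[k] X} {eb : (⨂[k]^b V) ≃ₗ[k] Y}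
  {ec : (⨂[k]^c V) ≃ₗ[k] Z}

/-- Coordinates are isomorphisms and cancel on both sides. This lemma turns each relation of the
prop into an axiom on `V` and back; both maps must be read in the same coordinates. -/
theorem eq_iff {F G : (⨂[k]^a V) →ₗ[k] ⨂[k]^b V} {f g : X →ₗ[k] Y} (hF : Realizes ea eb F f)
    (hG : Realizes ea eb G g) : F = G ↔ f = g := by
  unfold Realizes at hF hG
  rw [← LinearMap.cancel_right ea.surjective, ← hF, ← hG]
  exact (LinearMap.cancel_left eb.injective).symm

theorem id (e : (⨂[k]^a V) ≃ₗ[k] X) : Realizes e e LinearMap.id LinearMap.id := rfl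

theorem comp {F : (⨂[k]^a V) →ₗ[k] ⨂[k]^b V} {G : (⨂[k]^b V) →ₗ[k] ⨂[k]^c V} {f : X →ₗ[k] Y}
    {g : Y →ₗ[k] Z} (hG : Realizes eb ec G g) (hF : Realizes ea eb F f) :
    Realizes ea ec (G ∘ₗ F) (g ∘ₗ f) := by
  unfold Realizes at *
  rw [← LinearMap.comp_assoc, hG, LinearMap.comp_assoc, hF, LinearMap.comp_assoc]

theorem tensor {F : (⨂[k]^a V) →ₗ[k] ⨂[k]^b V} {G : (⨂[k]^c V) →ₗ[k] ⨂[k]^d V}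
    {f : X →ₗ[k] Y} {g : X' →ₗ[k] Y'} {ec : (⨂[k]^c V) ≃ₗ[k] X'} {ed : (⨂[k]^d V) ≃ₗ[k] Y'}
    (hF : Realizes ea eb F f) (hG : Realizes ec ed G g) :
    Realizes (mulPow ea ec) (mulPow eb ed) (tensorPow F G) (TensorProduct.map f g) :=
  tmulPow_ext fun x y => by
    have hx := LinearMap.congr_fun hF x
    have hy := LinearMap.congr_fun hG y
    simp only [LinearMap.comp_apply, LinearEquiv.coe_coe] at hx hy
    simp [hx, hy]

theorem swap (ea : (⨂[k]^a V) ≃ₗ[k] X) (eb : (⨂[k]^b V) ≃ₗ[k] Y) :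
    Realizes (mulPow ea eb) (mulPow eb ea) (swapPow k V a b)
      (TensorProduct.comm k X Y).toLinearMap :=
  tmulPow_ext fun x y => by simp

/-- Change of the identification of the source. -/
theorem trans_left {F : (⨂[k]^a V) →ₗ[k] ⨂[k]^b V} {f : X →ₗ[k] Y} (h : Realizes ea eb F f)
    {e : (⨂[k]^a V) ≃ₗ[k] Z} {i : Z →ₗ[k] X} (hi : Realizes e ea LinearMap.id i) :
    Realizes e eb F (f ∘ₗ i) :=
  h.comp hi

/-- Change of the identification of the target. -/
theorem trans_right {F : (⨂[k]^a V) →ₗ[k] ⨂[k]^b V} {f : X →ₗ[k] Y} (h : Realizes ea eb F f)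
    {e : (⨂[k]^b V) ≃ₗ[k] Z} {i : Y →ₗ[k] Z} (hi : Realizes eb e LinearMap.id i) :
    Realizes ea e F (i ∘ₗ f) :=
  hi.comp h

/-- On threefold concatenations the cast only moves brackets, by associativity of the tensor
algebra, and so does the associator. -/
theorem cast_assoc (ea : (⨂[k]^a V) ≃ₗ[k] X) (eb : (⨂[k]^b V) ≃ₗ[k] Y)
    (ec : (⨂[k]^c V) ≃ₗ[k] Z) :
    Realizes (mulPow (mulPow ea eb) ec) (mulPow ea (mulPow eb ec))
      (TensorPower.cast k V (Nat.add_assoc a b c)).toLinearMap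
      (TensorProduct.assoc k X Y Z).toLinearMap := by
  refine tmulPow_ext fun t z => ?_
  -- The element `t` of `V^{⊗(a+b)}` need not be a concatenation; with `z` fixed, both sides are
  -- linear in `t`, and extensionality applies a second time.
  have : ((mulPow ea (mulPow eb ec)).toLinearMap ∘ₗ
        (TensorPower.cast k V (Nat.add_assoc a b c)).toLinearMap) ∘ₗ
        TensorPower.mulEquiv.toLinearMap ∘ₗ (TensorProduct.mk k _ _).flip z =
      ((TensorProduct.assoc k X Y Z).toLinearMap ∘ₗ (mulPow (mulPow ea eb) ec).toLinearMap) ∘ₗ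
        TensorPower.mulEquiv.toLinearMap ∘ₗ (TensorProduct.mk k _ _).flip z := by
    refine tmulPow_ext fun x y => ?_
    change mulPow ea (mulPow eb ec) (TensorPower.cast k V _ (tmulPow (tmulPow x y) z)) =
      TensorProduct.assoc k X Y Z (mulPow (mulPow ea eb) ec (tmulPow (tmulPow x y) z))
    simp [tmulPow_assoc]
  exact LinearMap.congr_fun this t

theorem cast_rid (ea : (⨂[k]^a V) ≃ₗ[k] X) :
    Realizes (mulPow ea (pow0 k V)) ea (TensorPower.cast k V (Nat.add_zero a)).toLinearMap
      (TensorProduct.rid k X).toLinearMap := by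
  refine tmulPow_ext fun x y => ?_
  obtain ⟨s, rfl⟩ := (pow0 k V).symm.surjective y
  -- `V^{⊗0}` is the line spanned by the empty tensor, which is the unit for concatenation.
  have hs : (pow0 k V).symm s = s • PiTensorProduct.tprod k Fin.elim0 := by
    rw [LinearEquiv.symm_apply_eq, map_smul]
    simp [pow0]
  have h : tmulPow x (s • PiTensorProduct.tprod k Fin.elim0 : ⨂[k]^0 V) =
      s • tmulPow x (PiTensorProduct.tprod k Fin.elim0) := by
    simp [tmulPow]
  have h' := tmulPow_one x
  simp only [LinearMap.comp_apply, LinearEquiv.coe_coe, mulPow_tmulPow]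
  rw [LinearEquiv.apply_symm_apply, hs, h, map_smul, h', map_smul, TensorProduct.rid_tmul]

theorem symm {e : (⨂[k]^a V) ≃ₗ[k] X} {e' : (⨂[k]^a V) ≃ₗ[k] Y} {i : X ≃ₗ[k] Y}
    (h : Realizes e e' LinearMap.id i.toLinearMap) :
    Realizes e' e LinearMap.id i.symm.toLinearMap := by
  refine LinearMap.ext fun x => ?_
  have hx := LinearMap.congr_fun h x
  simp only [LinearMap.comp_apply, LinearEquiv.coe_coe, LinearMap.id_coe, id_eq] at hx ⊢
  rw [hx, LinearEquiv.symm_apply_apply]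

/-- For concrete numerals the two bracketings of a sum are the same natural number by computation,
so the cast in `cast_assoc` or `cast_rid` disappears. -/
theorem cast_self (h : a = a) :
    (TensorPower.cast k V h).toLinearMap = LinearMap.id := by
  rw [TensorPower.cast_refl]; rfl

end Realizes

end Realizes

/-! ## Boolean algebras and the relations of Boole -/

section Boolean

variable {k : Type u} [Field k] {V : Type v} [AddCommGroup V] [Module k V]

-- Here `2 + 1` and `1 + 2` both compute to `3`, and `pow2` unfolds to `mulPow` of two copies of
-- `pow1`. The cast becomes the identity, while the change of coordinates remains an associator.
variable (k V) in
theorem realizes_pow_assoc :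
    Realizes (mulPow (pow2 k V) (pow1 k V)) (mulPow (pow1 k V) (pow2 k V))
      (LinearMap.id : (⨂[k]^3 V) →ₗ[k] ⨂[k]^3 V) (TensorProduct.assoc k V V V).toLinearMap := by
  have h := Realizes.cast_assoc (pow1 k V) (pow1 k V) (pow1 k V)
  rwa [Realizes.cast_self (a := 3)] at h

variable (k V) in
theorem realizes_pow_rid :
    Realizes (mulPow (pow1 k V) (pow0 k V)) (pow1 k V)
      (LinearMap.id : (⨂[k]^1 V) →ₗ[k] ⨂[k]^1 V) (TensorProduct.rid k V).toLinearMap := by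
  have h := Realizes.cast_rid (pow1 k V)
  rwa [Realizes.cast_self (a := 1)] at h

theorem tensorPow_id (m n : ℕ) :
    tensorPow (LinearMap.id : (⨂[k]^m V) →ₗ[k] ⨂[k]^m V)
      (LinearMap.id : (⨂[k]^n V) →ₗ[k] ⨂[k]^n V) = LinearMap.id :=
  (EndPROP k V).tensor_id m n

-- The diagram for `I ⊗ S ⊗ I` is bracketed `(I ⊗ S) ⊗ I`, whereas its neighbours in the
-- distributive laws see `V^{⊗4}` as a product of two pairs. Splitting off the last strand and then
-- reassociating the first three links the two coordinates.
variable (k V) in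
theorem realizes_pow_four :
    Realizes (mulPow (pow2 k V) (pow2 k V)) (mulPow (mulPow (pow1 k V) (pow2 k V)) (pow1 k V))
      (LinearMap.id : (⨂[k]^4 V) →ₗ[k] ⨂[k]^4 V)
      ((TensorProduct.assoc k (V ⊗[k] V) V V).symm ≪≫ₗ
        TensorProduct.congr (TensorProduct.assoc k V V V) (.refl k V)).toLinearMap := by
  have h := Realizes.cast_assoc (pow2 k V) (pow1 k V) (pow1 k V)
  rw [Realizes.cast_self (a := 4)] at h
  have h' := (realizes_pow_assoc k V).tensor (.id (pow1 k V))
  rw [tensorPow_id 3 1] at h'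
  exact h'.comp h.symm

/-- The middle exchange `I ⊗ S ⊗ I`. -/
theorem realizes_middle_swap :
    Realizes (mulPow (pow2 k V) (pow2 k V)) (mulPow (pow2 k V) (pow2 k V))
      (tensorPow (a := 3) (b := 3)
        (tensorPow (LinearMap.id : (⨂[k]^1 V) →ₗ[k] ⨂[k]^1 V) (swapPow k V 1 1))
        (LinearMap.id : (⨂[k]^1 V) →ₗ[k] ⨂[k]^1 V))
      (TensorProduct.tensorTensorTensorComm k V V V V).toLinearMap := by
  have h := ((Realizes.id (pow1 k V)).tensor (.swap (pow1 k V) (pow1 k V))).tensor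
    (.id (pow1 k V))
  have h' := (h.trans_left (realizes_pow_four k V)).trans_right (realizes_pow_four k V).symm
  convert h' using 1
  -- The conjugate of `(I ⊗ S) ⊗ I` by the rebracketing is compared with the middle exchange on pure
  -- tensors.
  exact TensorProduct.ext_fourfold' fun a b c d => rfl

/-- Duplication next to two strands: `Δ ⊗ I ⊗ I`. -/
theorem realizes_tensor_id_id {F : (⨂[k]^1 V) →ₗ[k] ⨂[k]^2 V} {f : V →ₗ[k] V ⊗[k] V}
    (h : Realizes (pow1 k V) (pow2 k V) F f) :
    Realizes (mulPow (pow1 k V) (pow2 k V)) (mulPow (pow2 k V) (pow2 k V))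
      (tensorPow (a := 2) (b := 3) (tensorPow F (LinearMap.id : (⨂[k]^1 V) →ₗ[k] ⨂[k]^1 V))
        (LinearMap.id : (⨂[k]^1 V) →ₗ[k] ⨂[k]^1 V))
      (TensorProduct.map f LinearMap.id) := by
  -- Strict associativity in `End_V` merges the two identity strands into the identity of `V^{⊗2}`.
  have e : tensorPow (a := 2) (b := 3) (tensorPow F (LinearMap.id : (⨂[k]^1 V) →ₗ[k] ⨂[k]^1 V))
      (LinearMap.id : (⨂[k]^1 V) →ₗ[k] ⨂[k]^1 V) =
      tensorPow F (LinearMap.id : (⨂[k]^2 V) →ₗ[k] ⨂[k]^2 V) :=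
    ((EndPROP k V).tensor_assoc (a := 1) (a' := 2) (b := 1) (b' := 1) (c := 1) (c' := 1)
      F LinearMap.id LinearMap.id).trans (congrArg (tensorPow F) (tensorPow_id 1 1))
  have h' := h.tensor (.id (pow2 k V))
  rw [← e] at h'
  exact h'

/-- The vertices of Boole act through the operations `B`. -/
structure ActsThrough (act : ∀ n m, BooleGen n m → (⨂[k]^n V) →ₗ[k] ⨂[k]^m V)
    (B : LinearBooleanOps k V) : Prop where
  union : Realizes (pow2 k V) (pow1 k V) (act _ _ .union) B.union
  inter : Realizes (pow2 k V) (pow1 k V) (act _ _ .inter) B.inter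
  compl : Realizes (pow1 k V) (pow1 k V) (act _ _ .compl) B.compl
  total : Realizes (pow0 k V) (pow1 k V) (act _ _ .total) B.T
  empty : Realizes (pow0 k V) (pow1 k V) (act _ _ .empty) B.E
  coprod : Realizes (pow1 k V) (pow2 k V) (act _ _ .coprod) B.coprod
  ev : Realizes (pow1 k V) (pow0 k V) (act _ _ .ev) B.ev

/-- The value of a diagram as a linear map between tensor powers. -/
noncomputable def evalPow (act : ∀ n m, BooleGen n m → (⨂[k]^n V) →ₗ[k] ⨂[k]^m V) {n m : ℕ}
    (t : PropTerm BooleGen n m) : (⨂[k]^n V) →ₗ[k] ⨂[k]^m V :=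
  t.eval (EndPROP k V).toSetPROP act

namespace BooleTerm

variable {act : ∀ n m, BooleGen n m → (⨂[k]^n V) →ₗ[k] ⨂[k]^m V}

/-! ### Commutativity, associativity and unit relations -/

section Vertices

variable {g g' : BooleGen 2 1} {u : BooleGen 0 1} {f f' : V ⊗[k] V →ₗ[k] V} {z : k →ₗ[k] V}

theorem comm_iff (hf : Realizes (pow2 k V) (pow1 k V) (act _ _ g) f) :
    evalPow act (seq S (.gen g)) = evalPow act (.gen g) ↔
      f ∘ₗ (TensorProduct.comm k V V).toLinearMap = f :=
  Realizes.eq_iff (hf.comp (.swap (pow1 k V) (pow1 k V))) hf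

/-- The left side reads naturally from `(V ⊗ V) ⊗ V`, the right side from `V ⊗ (V ⊗ V)`; the
associator brings the right side to the coordinates of the left. -/
theorem assoc_iff (hf : Realizes (pow2 k V) (pow1 k V) (act _ _ g) f) :
    evalPow act (seq (par (.gen g) I :) (.gen g) : Diag 3 1) =
        evalPow act (seq (par I (.gen g) :) (.gen g)) ↔
      f ∘ₗ TensorProduct.map f LinearMap.id =
        f ∘ₗ TensorProduct.map LinearMap.id f ∘ₗ (TensorProduct.assoc k V V V).toLinearMap :=
  Realizes.eq_iff (hf.comp (hf.tensor (.id (pow1 k V))))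
    (hf.comp (((Realizes.id (pow1 k V)).tensor hf).trans_left (realizes_pow_assoc k V)))

/-- The source strand is read as `V ⊗ k`, so on the right the identity strand becomes the unitor. -/
theorem unit_iff (hf : Realizes (pow2 k V) (pow1 k V) (act _ _ g) f)
    (hz : Realizes (pow0 k V) (pow1 k V) (act _ _ u) z) :
    evalPow act (seq (par I (.gen u) :) (.gen g) : Diag 1 1) = evalPow act I ↔
      f ∘ₗ TensorProduct.map LinearMap.id z = (TensorProduct.rid k V).toLinearMap :=
  Realizes.eq_iff (hf.comp ((Realizes.id (pow1 k V)).tensor hz)) (realizes_pow_rid k V)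

end Vertices

/-! ### Relations involving the coproduct -/

variable {B : LinearBooleanOps k V} (h : ActsThrough act B)
  {g g' : BooleGen 2 1} {u : BooleGen 0 1} {f f' : V ⊗[k] V →ₗ[k] V} {z : k →ₗ[k] V}
include h

/-- Keeping the two binary vertices arbitrary covers both distributive laws. The right side is read
through the pairing of `V^{⊗4}` into two copies of `V ⊗ V`. -/
theorem distrib_iff (hf : Realizes (pow2 k V) (pow1 k V) (act _ _ g) f)
    (hf' : Realizes (pow2 k V) (pow1 k V) (act _ _ g') f') :
    evalPow act (seq (par I (.gen g') :) (.gen g) : Diag 3 1) =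
        evalPow act (seq (par (par coprod I) I :) (seq (par (par I S) I :)
          (seq (par (.gen g) (.gen g) :) (.gen g')))) ↔
      f ∘ₗ TensorProduct.map LinearMap.id f' =
        f' ∘ₗ TensorProduct.map f f ∘ₗ
          (TensorProduct.tensorTensorTensorComm k V V V V).toLinearMap ∘ₗ
          TensorProduct.map B.coprod LinearMap.id :=
  Realizes.eq_iff (hf.comp ((Realizes.id (pow1 k V)).tensor hf'))
    (((hf'.comp (hf.tensor hf)).comp realizes_middle_swap).comp (realizes_tensor_id_id h.coprod))

theorem compl_iff (hf : Realizes (pow2 k V) (pow1 k V) (act _ _ g) f)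
    (hz : Realizes (pow0 k V) (pow1 k V) (act _ _ u) z) :
    evalPow act (seq coprod (seq (par I compl :) (.gen g)) : Diag 1 1) =
        evalPow act (seq ev (.gen u)) ↔
      f ∘ₗ TensorProduct.map LinearMap.id B.compl ∘ₗ B.coprod = z ∘ₗ B.ev :=
  Realizes.eq_iff (hf.comp (((Realizes.id (pow1 k V)).tensor h.compl).comp h.coprod))
    (hz.comp h.ev)

theorem absorb_iff (hf : Realizes (pow2 k V) (pow1 k V) (act _ _ g) f)
    (hf' : Realizes (pow2 k V) (pow1 k V) (act _ _ g') f') :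
    evalPow act (seq (par coprod I :) (seq (par I (.gen g') :) (.gen g)) : Diag 2 1) =
        evalPow act (par I ev :) ↔
      f ∘ₗ TensorProduct.map LinearMap.id f' ∘ₗ (TensorProduct.assoc k V V V).toLinearMap ∘ₗ
          TensorProduct.map B.coprod LinearMap.id =
        (TensorProduct.rid k V).toLinearMap ∘ₗ TensorProduct.map LinearMap.id B.ev :=
  Realizes.eq_iff
    (hf.comp ((((Realizes.id (pow1 k V)).tensor hf').comp (realizes_pow_assoc k V)).comp
      (h.coprod.tensor (.id (pow1 k V)))))
    (((Realizes.id (pow1 k V)).tensor h.ev).trans_right (realizes_pow_rid k V))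

theorem coassoc_iff :
    evalPow act (seq coprod (par coprod I :) : Diag 1 3) =
        evalPow act (seq coprod (par I coprod :)) ↔
      (TensorProduct.assoc k V V V).toLinearMap ∘ₗ TensorProduct.map B.coprod LinearMap.id ∘ₗ
          B.coprod = TensorProduct.map LinearMap.id B.coprod ∘ₗ B.coprod :=
  Realizes.eq_iff
    (((h.coprod.tensor (.id (pow1 k V))).comp h.coprod).trans_right (realizes_pow_assoc k V))
    (((Realizes.id (pow1 k V)).tensor h.coprod).comp h.coprod)

theorem cocomm_iff :
    evalPow act (seq coprod S) = evalPow act coprod ↔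
      (TensorProduct.comm k V V).toLinearMap ∘ₗ B.coprod = B.coprod :=
  Realizes.eq_iff ((Realizes.swap (pow1 k V) (pow1 k V)).comp h.coprod) h.coprod

end BooleTerm
end Boolean

/-! ### The bijection between algebra structures and Boolean algebra structures -/

section Equivalence

variable {k : Type u} [Field k] {V : Type v} [AddCommGroup V] [Module k V]

/-- The action of the vertices of Boole on the tensor powers of `V` given by operations on `V`. -/
noncomputable def LinearBooleanOps.act (B : LinearBooleanOps k V) :
    ∀ n m, BooleGen n m → (⨂[k]^n V) →ₗ[k] ⨂[k]^m V
  | _, _, .union => (pow1 k V).symm.toLinearMap ∘ₗ B.union ∘ₗ (pow2 k V).toLinearMap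
  | _, _, .inter => (pow1 k V).symm.toLinearMap ∘ₗ B.inter ∘ₗ (pow2 k V).toLinearMap
  | _, _, .compl => (pow1 k V).symm.toLinearMap ∘ₗ B.compl ∘ₗ (pow1 k V).toLinearMap
  | _, _, .coprod => (pow2 k V).symm.toLinearMap ∘ₗ B.coprod ∘ₗ (pow1 k V).toLinearMap
  | _, _, .empty => (pow1 k V).symm.toLinearMap ∘ₗ B.E ∘ₗ (pow0 k V).toLinearMap
  | _, _, .total => (pow1 k V).symm.toLinearMap ∘ₗ B.T ∘ₗ (pow0 k V).toLinearMap
  | _, _, .ev => (pow0 k V).symm.toLinearMap ∘ₗ B.ev ∘ₗ (pow1 k V).toLinearMap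

variable {X Y : Type*} [AddCommGroup X] [Module k X] [AddCommGroup Y] [Module k Y]

theorem realizes_conj {n m : ℕ} (e : (⨂[k]^n V) ≃ₗ[k] X) (e' : (⨂[k]^m V) ≃ₗ[k] Y)
    (f : X →ₗ[k] Y) : Realizes e e' (e'.symm.toLinearMap ∘ₗ f ∘ₗ e.toLinearMap) f :=
  LinearMap.ext fun x => by simp

theorem realizes_conj' {n m : ℕ} (e : (⨂[k]^n V) ≃ₗ[k] X) (e' : (⨂[k]^m V) ≃ₗ[k] Y)
    (F : (⨂[k]^n V) →ₗ[k] ⨂[k]^m V) :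
    Realizes e e' F (e'.toLinearMap ∘ₗ F ∘ₗ e.symm.toLinearMap) :=
  LinearMap.ext fun x => by simp

/-- The map on tensor powers is determined by the map it realizes. -/
theorem Realizes.unique {n m : ℕ} {e : (⨂[k]^n V) ≃ₗ[k] X} {e' : (⨂[k]^m V) ≃ₗ[k] Y}
    {F G : (⨂[k]^n V) →ₗ[k] ⨂[k]^m V} {f : X →ₗ[k] Y} (hF : Realizes e e' F f)
    (hG : Realizes e e' G f) : F = G :=
  (hF.eq_iff hG).2 rfl

/-- The map realized by a map on tensor powers is unique. -/
theorem Realizes.unique_right {n m : ℕ} {e : (⨂[k]^n V) ≃ₗ[k] X} {e' : (⨂[k]^m V) ≃ₗ[k] Y}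
    {F : (⨂[k]^n V) →ₗ[k] ⨂[k]^m V} {f g : X →ₗ[k] Y} (hf : Realizes e e' F f)
    (hg : Realizes e e' F g) : f = g :=
  (hf.eq_iff hg).1 rfl

/-- With `ActsThrough.ops_eq`, this says that actions and operations determine each other; the two
lemmas give the two inverse laws of the bijection. -/
theorem ActsThrough.act_eq {act act' : ∀ n m, BooleGen n m → (⨂[k]^n V) →ₗ[k] ⨂[k]^m V}
    {B : LinearBooleanOps k V} (h : ActsThrough act B) (h' : ActsThrough act' B) :
    act = act' := by
  funext n m g
  cases g
  · exact h.union.unique h'.union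
  · exact h.inter.unique h'.inter
  · exact h.compl.unique h'.compl
  · exact h.coprod.unique h'.coprod
  · exact h.empty.unique h'.empty
  · exact h.total.unique h'.total
  · exact h.ev.unique h'.ev

theorem ActsThrough.ops_eq {act : ∀ n m, BooleGen n m → (⨂[k]^n V) →ₗ[k] ⨂[k]^m V}
    {B B' : LinearBooleanOps k V} (h : ActsThrough act B) (h' : ActsThrough act B') :
    B = B' :=
  LinearBooleanOps.ext (h.union.unique_right h'.union) (h.inter.unique_right h'.inter)
    (h.compl.unique_right h'.compl) (h.total.unique_right h'.total)
    (h.empty.unique_right h'.empty) (h.coprod.unique_right h'.coprod)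
    (h.ev.unique_right h'.ev)

theorem LinearBooleanOps.actsThrough_act (B : LinearBooleanOps k V) : ActsThrough B.act B where
  union := realizes_conj _ _ _
  inter := realizes_conj _ _ _
  compl := realizes_conj _ _ _
  total := realizes_conj _ _ _
  empty := realizes_conj _ _ _
  coprod := realizes_conj _ _ _
  ev := realizes_conj _ _ _

/-- The action of the vertices in an algebra over `⟨Boole⟩`. -/
noncomputable def booleActs (r : (Boole.linearize k).AlgebraOn V) :
    ∀ n m, BooleGen n m → (⨂[k]^n V) →ₗ[k] ⨂[k]^m V :=
  fun _ _ g => booleAct r g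

theorem actsThrough_booleOps (r : (Boole.linearize k).AlgebraOn V) :
    ActsThrough (booleActs r) (booleOps r) where
  union := realizes_conj' _ _ _
  inter := realizes_conj' _ _ _
  compl := realizes_conj' _ _ _
  total := realizes_conj' _ _ _
  empty := realizes_conj' _ _ _
  coprod := realizes_conj' _ _ _
  ev := realizes_conj' _ _ _

/-- After unfolding, `booleActs r` is `r.onGen` and `evalPow` is evaluation in the endomorphism
prop. -/
theorem booleActs_rel (r : (Boole.linearize k).AlgebraOn V) {n m : ℕ}
    {f g : PropTerm BooleGen n m} (h : BooleRel n m f g) :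
    evalPow (booleActs r) f = evalPow (booleActs r) g :=
  LinPROP.Morphism.onGen_rel (G := BooleGen) (R := BooleRel) r n m f g h

open BooleTerm

/-- The Boolean algebra structure defined by an algebra over `⟨Boole⟩`. -/
noncomputable def booleAlgebra (r : (Boole.linearize k).AlgebraOn V) :
    LinearBooleanAlgebra k V :=
  have h := actsThrough_booleOps r
  { booleOps r with
    union_comm := (comm_iff h.union).1 (booleActs_rel r .union_comm)
    inter_comm := (comm_iff h.inter).1 (booleActs_rel r .inter_comm)
    union_assoc := (assoc_iff h.union).1 (booleActs_rel r .union_assoc)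
    inter_assoc := (assoc_iff h.inter).1 (booleActs_rel r .inter_assoc)
    inter_union_distrib :=
      (distrib_iff h h.inter h.union).1 (booleActs_rel r .inter_union_distrib)
    union_inter_distrib :=
      (distrib_iff h h.union h.inter).1 (booleActs_rel r .union_inter_distrib)
    union_empty := (unit_iff h.union h.empty).1 (booleActs_rel r .union_empty)
    inter_total := (unit_iff h.inter h.total).1 (booleActs_rel r .inter_total)
    inter_compl := (compl_iff h h.inter h.empty).1 (booleActs_rel r .inter_compl)
    union_compl := (compl_iff h h.union h.total).1 (booleActs_rel r .union_compl)
    inter_absorb := (absorb_iff h h.inter h.union).1 (booleActs_rel r .inter_absorb)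
    union_absorb := (absorb_iff h h.union h.inter).1 (booleActs_rel r .union_absorb)
    coassoc := (coassoc_iff h).1 (booleActs_rel r .coassoc)
    cocomm := (cocomm_iff h).1 (booleActs_rel r .cocomm) }

theorem LinearBooleanAlgebra.act_rel (B : LinearBooleanAlgebra k V) (n m : ℕ)
    (f g : PropTerm BooleGen n m) (hfg : BooleRel n m f g) :
    evalPow B.act f = evalPow B.act g := by
  have h := B.actsThrough_act
  cases hfg with
  | union_comm => exact (comm_iff h.union).2 B.union_comm
  | inter_comm => exact (comm_iff h.inter).2 B.inter_comm
  | union_assoc => exact (assoc_iff h.union).2 B.union_assoc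
  | inter_assoc => exact (assoc_iff h.inter).2 B.inter_assoc
  | inter_union_distrib => exact (distrib_iff h h.inter h.union).2 B.inter_union_distrib
  | union_inter_distrib => exact (distrib_iff h h.union h.inter).2 B.union_inter_distrib
  | union_empty => exact (unit_iff h.union h.empty).2 B.union_empty
  | inter_total => exact (unit_iff h.inter h.total).2 B.inter_total
  | inter_compl => exact (compl_iff h h.inter h.empty).2 B.inter_compl
  | union_compl => exact (compl_iff h h.union h.total).2 B.union_compl
  | inter_absorb => exact (absorb_iff h h.inter h.union).2 B.inter_absorb
  | union_absorb => exact (absorb_iff h h.union h.inter).2 B.union_absorb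
  | coassoc => exact (coassoc_iff h).2 B.coassoc
  | cocomm => exact (cocomm_iff h).2 B.cocomm

/-- The `⟨Boole⟩`-algebra structure defined by a Boolean algebra structure. -/
noncomputable def LinearBooleanAlgebra.toAlgebraOn (B : LinearBooleanAlgebra k V) :
    (Boole.linearize k).AlgebraOn V :=
  SetPROP.presentedLift (G := BooleGen) (R := BooleRel) (Q := EndPROP k V) B.act B.act_rel

theorem LinearBooleanAlgebra.booleActs_toAlgebraOn (B : LinearBooleanAlgebra k V) :
    booleActs B.toAlgebraOn = B.act := by
  funext n m g
  exact SetPROP.presentedLift_gen (G := BooleGen) (R := BooleRel) (Q := EndPROP k V) B.act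
    B.act_rel g

/-- Algebras over `⟨Boole⟩` on `V` are Boolean algebra structures on `V`. -/
noncomputable def booleAlgebraEquiv :
    (Boole.linearize k).AlgebraOn V ≃ LinearBooleanAlgebra k V where
  toFun := booleAlgebra
  invFun B := B.toAlgebraOn
  left_inv r := by
    refine LinPROP.Morphism.presented_ext (G := BooleGen) (R := BooleRel) ?_
    have h := (booleAlgebra r).actsThrough_act
    -- The original and the reconstructed action both act through `booleOps r`, hence coincide.
    exact (booleAlgebra r).booleActs_toAlgebraOn.trans (h.act_eq (actsThrough_booleOps r))
  right_inv B := by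
    have h := actsThrough_booleOps B.toAlgebraOn
    rw [B.booleActs_toAlgebraOn] at h
    have e : (booleAlgebra B.toAlgebraOn).toLinearBooleanOps = B.toLinearBooleanOps :=
      h.ops_eq B.actsThrough_act
    -- The axioms are propositions, so equality of the seven operations suffices.
    exact LinearBooleanAlgebra.ext (congrArg LinearBooleanOps.union e)
      (congrArg LinearBooleanOps.inter e) (congrArg LinearBooleanOps.compl e)
      (congrArg LinearBooleanOps.T e) (congrArg LinearBooleanOps.E e)
      (congrArg LinearBooleanOps.coprod e) (congrArg LinearBooleanOps.ev e)

end Equivalence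

theorem mainTheorem4 {k : Type u} [Field k] [CharZero k] {V : Type v} [AddCommGroup V]
    [Module k V] :
    ∃ e : (Boole.linearize k).AlgebraOn V ≃ LinearBooleanAlgebra k V,
      ∀ r : (Boole.linearize k).AlgebraOn V, (e r).toLinearBooleanOps = booleOps r :=
  -- `booleAlgebra r` only adds proofs to `booleOps r`, so the bijection is the prescribed map by
  -- definition.
  ⟨booleAlgebraEquiv, fun _ => rfl⟩
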